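/- Let $\mathcal A$ be a finite set, $P$ a probability distribution on $\mathcal A$, $\mathcal H_E$ a finite-dimensional Hilbert space, and $(\rho_a)_{a\in\mathcal A}$ density matrices on $\mathcal H_E$. Put $\rho=\sum_a P(a)|a\rangle\langle a|\otimes\rho_a$ and $\rho^E=\mathrm{Tr}_A\,\rho=\sum_a P(a)\rho_a$, and let $v$ be the number of distinct eigenvalues of $\rho^E$. Let $M\ge 1$ be an integer. For $f:\mathcal A\to\{1,\dots,M\}$ let $$\rho_f=\sum_{i=1}^M |i\rangle\langle i|\otimes\sum_{a:f(a)=i}P(a)\rho_a$$ be the state of $f(A)$ and $E$; its marginal on $E$ is $\rho^E$. Define $$H(f(A)|E|\rho)=-\mathrm{Tr}\,\rho_f\log\rho_f+\mathrm{Tr}\,\rho^E\log\rho^E,\qquad I'(f(A):E|\rho)=\mathrm{Tr}\,\rho_f\Bigl(\log\rho_f-\log\bigl(\tfrac1M I\otimes\rho^E\bigr)\Bigr),$$ $$H_{1+s}(A|E|\rho)=-\frac1s\log\mathrm{Tr}\,\rho^{1+s}\,\bigl(I_A\otimes(\rho^E)^{-s}\bigr),$$ where logarithms are natural and logarithms and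 negative powers of positive semidefinite matrices are taken on the support. Then there exists a function $f:\mathcal A\to\{1,\dots,M\}$ such that, for every $s\in(0,1]$, $$\log M-H(f(A)|E|\rho)=I'(f(A):E|\rho)\le\log v+\frac{\log 2}{s}+\max\{0,\ \log M-H_{1+s}(A|E|\rho)\}.$$ -/

import Mathlib

open scoped Kronecker ComplexOrder

noncomputable section

namespace QPA

variable {A E : Type*} [Fintype A] [DecidableEq A] [Fintype E] [DecidableEq E]

/-- Density matrices: positive semidefinite with trace one. -/
def IsDensity (τ : Matrix E E ℂ) : Prop :=
  τ.PosSemidef ∧ τ.trace = 1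

/-- `P` is a probability distribution on the finite set `A`. -/
def IsProb (P : A → ℝ) : Prop :=
  (∀ a, 0 ≤ P a) ∧ ∑ a, P a = 1

/-- Logarithm (natural base) of a Hermitian matrix by functional calculus. Since
`Real.log 0 = 0`, for a positive semidefinite matrix it is the logarithm on the support, and `0`
on the kernel. -/
def matLog (X : Matrix E E ℂ) : Matrix E E ℂ :=
  cfc Real.log X

/-- The power `X ^ t` of a positive semidefinite matrix by functional calculus. Since
`(0 : ℝ) ^ t = 0` for `t ≠ 0`, negative powers are powers of the inverse on the support. -/
def matPow (X : Matrix E E ℂ) (t : ℝ) : Matrix E E ℂ :=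
  cfc (fun x : ℝ => x ^ t) X

/-- The von Neumann entropy `- Tr ρ log ρ`. -/
def vnEntropy (ρ : Matrix E E ℂ) : ℝ :=
  -(ρ * matLog ρ).trace.re

/-- The quantum relative entropy `D(ρ‖σ) = Tr ρ (log ρ - log σ)`, for states such that the support
of `ρ` is contained in the support of `σ` (otherwise the relative entropy is infinite; this does
not occur below, where `σ` is the tensor product of the completely mixed state on `A` with the
marginal of `ρ` on `E`). -/
def relEntropy (ρ σ : Matrix E E ℂ) : ℝ :=
  (ρ * (matLog ρ - matLog σ)).trace.re

/-- The marginal `ρ^E = Tr_A ρ` of a state on the composite system. -/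
def marginalE (ρ : Matrix (A × E) (A × E) ℂ) : Matrix E E ℂ :=
  Matrix.of fun x y => ∑ a, ρ (a, x) (a, y)

/-- The completely mixed state on `A`. -/
def mixed (A : Type*) [Fintype A] [DecidableEq A] : Matrix A A ℂ :=
  ((Fintype.card A : ℂ)⁻¹) • (1 : Matrix A A ℂ)

/-- The conditional entropy `H(A|E|ρ) = H(A,E|ρ) - H(E|ρ)`. -/
def condEntropy (ρ : Matrix (A × E) (A × E) ℂ) : ℝ :=
  vnEntropy ρ - vnEntropy (marginalE ρ)

/-- The conditional Rényi entropy
`H_{1+s}(A|E|ρ) = -(1/s) log Tr ρ^{1+s} (I_A ⊗ (ρ^E)^{-s})`. -/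
def condRenyi (s : ℝ) (ρ : Matrix (A × E) (A × E) ℂ) : ℝ :=
  (-1 / s) *
    Real.log
      (matPow ρ (1 + s) * ((1 : Matrix A A ℂ) ⊗ₖ matPow (marginalE ρ) (-s))).trace.re

/-- The modified mutual information `I'(A:E|ρ) = D(ρ ‖ ρ_mix^A ⊗ ρ^E)`. -/
def modMutualInfo (ρ : Matrix (A × E) (A × E) ℂ) : ℝ :=
  relEntropy ρ (mixed A ⊗ₖ marginalE ρ)

/-- The classical-quantum state `∑ a, P(a) |a⟩⟨a| ⊗ ρ_a`. -/
def cqState (P : A → ℝ) (ρ : A → Matrix E E ℂ) : Matrix (A × E) (A × E) ℂ :=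
  ∑ a, (P a : ℂ) • (Matrix.single a a (1 : ℂ) ⊗ₖ ρ a)

/-- The state of `f(A)` and `E`: `∑ i, |i⟩⟨i| ⊗ ∑_{a : f(a) = i} P(a) ρ_a`. -/
def hashedState {M : ℕ} (P : A → ℝ) (ρ : A → Matrix E E ℂ) (f : A → Fin M) :
    Matrix (Fin M × E) (Fin M × E) ℂ :=
  ∑ i, Matrix.single i i (1 : ℂ) ⊗ₖ (∑ a with f a = i, (P a : ℂ) • ρ a)

/-- The number of (distinct) eigenvalues of a matrix. -/
def numEigenvalues (σ : Matrix E E ℂ) : ℕ :=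
  (spectrum ℂ σ).ncard

end QPA

end

set_option linter.unusedSectionVars false

namespace QPA

/-! ### Functional calculus of Hermitian matrices through polynomial interpolation -/

section FunctionalCalculus

variable {n m : Type*} [Fintype n] [DecidableEq n] [Fintype m] [DecidableEq m]

/-! Write `X a` for P(a)ρ_a and R for their sum, and choose f uniformly among all functions. For
each a, pick an eigenbasis of R in which `X a` has no off-diagonal entry inside an eigenspace of R.
The diagonal `y a` of `X a` in that basis is then its pinching, and the pinching inequality gives
X_a ≤ v·diag(y_a) (`posSemidef_smul_diagonal_sub`). The fiber of f containing a always receives `X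
a`, and every other b with probability 1/M, so its mean operator is X_a + (R - X_a)/M ≤ v·diag(y_a)
+ R/M. Operator concavity and monotonicity of the logarithm (`sum_re_trace_mul_matLog_le`) bound the
mean of Tr X_a log(fiber operator) by ∑_j y_aj log(v y_aj + r_aj/M), and some f does no worse than
the mean (`exists_hash_entropy_le`).

Everything left is scalar (`sum_mul_log_le`): log(1+x) ≤ (1/s) log(1+x^s), then Jensen, turns the
excess over log v into (1/s) log(1 + M^s ∑ y^{1+s} r^{-s}). The sum is at most the Rényi trace,
since y^{1+s} is dominated by the diagonal of X_a^{1+s} (`rpow_diag_le`). The averaged quantity does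
not involve s, so one f serves all s. -/

lemma exists_polynomial_eval_eq {S : Set ℝ} (hS : S.Finite) (f : ℝ → ℝ) :
    ∃ p : Polynomial ℝ, ∀ x ∈ S, p.eval x = f x := by
  classical
  refine ⟨Lagrange.interpolate hS.toFinset id f, fun x hx => ?_⟩
  exact Lagrange.eval_interpolate_at_node (v := id) f (Set.injOn_id _) (by simpa using hx)

lemma cfc_eq_aeval {X : Matrix n n ℂ} (hX : X.IsHermitian) {f : ℝ → ℝ} {p : Polynomial ℝ}
    (h : ∀ x ∈ spectrum ℝ X, p.eval x = f x) : cfc f X = Polynomial.aeval X p := by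
  rw [← cfc_polynomial p X hX]
  exact cfc_congr fun x hx => (h x hx).symm

/-- Spectra are finite, so a single polynomial interpolates `f` on both of them, and algebra
homomorphisms commute with polynomials. -/
lemma cfc_algHom (φ : Matrix n n ℂ →ₐ[ℝ] Matrix m m ℂ) {X : Matrix n n ℂ} (hX : X.IsHermitian)
    (hφ : (φ X).IsHermitian) (f : ℝ → ℝ) : cfc f (φ X) = φ (cfc f X) := by
  obtain ⟨p, hp⟩ := exists_polynomial_eval_eq
    ((Matrix.finite_real_spectrum (A := X)).union (Matrix.finite_real_spectrum (A := φ X))) f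
  rw [cfc_eq_aeval hX fun x hx => hp x (Or.inl hx), cfc_eq_aeval hφ fun x hx => hp x (Or.inr hx),
    Polynomial.aeval_algHom_apply]

lemma isHermitian_diagonal_ofReal (d : n → ℝ) :
    (Matrix.diagonal fun i => (d i : ℂ)).IsHermitian :=
  Matrix.isHermitian_diagonal_of_self_adjoint _ (by ext i; simp)

lemma cfc_diagonal (d : n → ℝ) (f : ℝ → ℝ) :
    cfc f (Matrix.diagonal fun i => (d i : ℂ)) = Matrix.diagonal fun i => (f (d i) : ℂ) := by
  obtain ⟨p, hp⟩ := exists_polynomial_eval_eq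
    ((Matrix.finite_real_spectrum (A := Matrix.diagonal fun i => (d i : ℂ))).union
      (Set.finite_range d)) f
  rw [cfc_eq_aeval (isHermitian_diagonal_ofReal d) fun x hx => hp x (Or.inl hx)]
  have h := Polynomial.aeval_algHom_apply (Matrix.diagonalAlgHom (n := n) (α := ℂ) ℝ)
    (fun i => (d i : ℂ)) p
  simp only [Matrix.diagonalAlgHom_apply] at h
  rw [h, Polynomial.aeval_pi]
  congr 1
  ext i
  rw [← hp (d i) (Or.inr ⟨i, rfl⟩)]
  exact Polynomial.aeval_algebraMap_apply ℂ (d i) p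

lemma cfc_conj_diagonal (U : Matrix.unitaryGroup n ℂ) (d : n → ℝ) (f : ℝ → ℝ) :
    cfc f ((U : Matrix n n ℂ) * Matrix.diagonal (fun i => (d i : ℂ)) * star (U : Matrix n n ℂ)) =
      (U : Matrix n n ℂ) * Matrix.diagonal (fun i => (f (d i) : ℂ)) * star (U : Matrix n n ℂ) := by
  have h := cfc_algHom (Unitary.conjStarAlgAut ℝ (Matrix n n ℂ) U).toAlgEquiv.toAlgHom
    (isHermitian_diagonal_ofReal d) (by
      simpa [Matrix.star_eq_conjTranspose] using
        Matrix.isHermitian_mul_mul_conjTranspose (U : Matrix n n ℂ)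
        (isHermitian_diagonal_ofReal d)) f
  rw [cfc_diagonal] at h
  simpa using h

lemma exists_unitary_conj_diagonal {X : Matrix n n ℂ} (hX : X.IsHermitian) :
    ∃ (V : Matrix.unitaryGroup n ℂ) (x : n → ℝ), X = (V : Matrix n n ℂ) *
      Matrix.diagonal (fun i => (x i : ℂ)) * star (V : Matrix n n ℂ) :=
  ⟨hX.eigenvectorUnitary, hX.eigenvalues, by
    simpa [Unitary.conjStarAlgAut_apply, Function.comp_def] using hX.spectral_theorem⟩

end FunctionalCalculus

/-! ### Classical-quantum states as block diagonal matrices, and their entropies -/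

section BlockDiagonal

variable {A E : Type*} [Fintype A] [DecidableEq A] [Fintype E] [DecidableEq E]

/-- The block diagonal matrix with blocks `σ a`, as an algebra homomorphism. -/
noncomputable def blockHom : (A → Matrix E E ℂ) →ₐ[ℝ] Matrix (A × E) (A × E) ℂ :=
  AlgHom.ofLinearMap
    { toFun := fun σ => Matrix.of fun p q => if p.1 = q.1 then σ p.1 p.2 q.2 else 0
      map_add' := fun σ τ => by ext p q; by_cases h : p.1 = q.1 <;> simp [h]
      map_smul' := fun c σ => by ext p q; by_cases h : p.1 = q.1 <;> simp [h] }
    (by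
      ext ⟨a, x⟩ ⟨b, y⟩
      by_cases h : a = b <;> simp [h, Matrix.one_apply])
    (fun σ τ => by
      ext ⟨a, x⟩ ⟨b, y⟩
      by_cases h : a = b <;> simp [h, Matrix.mul_apply, Fintype.sum_prod_type])

lemma blockHom_apply (σ : A → Matrix E E ℂ) (p q : A × E) :
    blockHom σ p q = if p.1 = q.1 then σ p.1 p.2 q.2 else 0 := rfl

lemma sum_single_kronecker (σ : A → Matrix E E ℂ) :
    ∑ a, Matrix.single a a (1 : ℂ) ⊗ₖ σ a = blockHom σ := by
  ext ⟨a, x⟩ ⟨b, y⟩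
  simp only [Matrix.sum_apply, Matrix.kroneckerMap_apply, Matrix.single_apply, blockHom_apply]
  by_cases h : a = b
  · subst h; simp
  · simp only [h, if_false]
    refine Finset.sum_eq_zero fun c _ => ?_
    rw [if_neg (fun hc => h (hc.1.symm.trans hc.2)), zero_mul]

lemma one_kronecker_eq_blockHom (τ : Matrix E E ℂ) :
    (1 : Matrix A A ℂ) ⊗ₖ τ = blockHom fun _ => τ := by
  ext ⟨a, x⟩ ⟨b, y⟩
  simp [blockHom_apply, Matrix.one_apply]

lemma trace_blockHom (σ : A → Matrix E E ℂ) : (blockHom σ).trace = ∑ a, (σ a).trace := by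
  simp [Matrix.trace, Fintype.sum_prod_type, blockHom_apply]

lemma marginalE_blockHom (σ : A → Matrix E E ℂ) : marginalE (blockHom σ) = ∑ a, σ a := by
  ext x y
  simp [marginalE, blockHom_apply, Matrix.sum_apply]

lemma isHermitian_blockHom {σ : A → Matrix E E ℂ} (hσ : ∀ a, (σ a).IsHermitian) :
    (blockHom σ).IsHermitian := by
  ext ⟨a, x⟩ ⟨b, y⟩
  simp only [Matrix.conjTranspose_apply, blockHom_apply]
  by_cases h : a = b
  · subst h; simpa using (hσ a).apply x y
  · simp [h, Ne.symm h]

/-- One polynomial interpolating `f` on the spectra of all blocks and of the whole matrix acts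
blockwise. -/
lemma cfc_blockHom {σ : A → Matrix E E ℂ} (hσ : ∀ a, (σ a).IsHermitian) (f : ℝ → ℝ) :
    cfc f (blockHom σ) = blockHom fun a => cfc f (σ a) := by
  obtain ⟨p, hp⟩ := exists_polynomial_eval_eq
    ((Matrix.finite_real_spectrum (A := blockHom σ)).union
      (Set.finite_iUnion fun a => Matrix.finite_real_spectrum (A := σ a))) f
  rw [cfc_eq_aeval (isHermitian_blockHom hσ) fun x hx => hp x (Or.inl hx),
    Polynomial.aeval_algHom_apply, Polynomial.aeval_pi]
  congr 1
  ext1 a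
  rw [cfc_eq_aeval (hσ a) fun x hx => hp x (Or.inr (Set.mem_iUnion.2 ⟨a, hx⟩))]
  rfl

lemma cqState_eq_blockHom (P : A → ℝ) (ρ : A → Matrix E E ℂ) :
    cqState P ρ = blockHom fun a => (P a : ℂ) • ρ a := by
  rw [← sum_single_kronecker]
  simp [cqState, Matrix.kronecker_smul]

lemma hashedState_eq_blockHom {M : ℕ} (P : A → ℝ) (ρ : A → Matrix E E ℂ) (f : A → Fin M) :
    hashedState P ρ f = blockHom fun i => ∑ a with f a = i, (P a : ℂ) • ρ a :=
  sum_single_kronecker _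

lemma vnEntropy_blockHom {σ : A → Matrix E E ℂ} (hσ : ∀ a, (σ a).IsHermitian) :
    vnEntropy (blockHom σ) = -∑ a, (σ a * matLog (σ a)).trace.re := by
  rw [vnEntropy, matLog, cfc_blockHom hσ, ← map_mul, trace_blockHom, Complex.re_sum]
  rfl

/-- The relative entropy of a state with respect to the tensor product of the completely mixed
state and the marginal, in terms of entropies. -/
lemma modMutualInfo_blockHom [Nonempty A] {σ : A → Matrix E E ℂ} (hσ : ∀ a, (σ a).IsHermitian)
    (htr : (∑ a, σ a).trace = 1) :
    modMutualInfo (blockHom σ) =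
      Real.log (Fintype.card A) + ∑ a, (σ a * matLog (σ a)).trace.re -
        ((∑ a, σ a) * matLog (∑ a, σ a)).trace.re := by
  have hR : (∑ a, σ a).IsHermitian := by
    simpa [Matrix.IsHermitian, Matrix.conjTranspose_sum] using
      Finset.sum_congr rfl fun a _ => hσ a
  have hmix : mixed A ⊗ₖ (∑ a, σ a) =
      blockHom fun _ : A => ((Fintype.card A : ℝ)⁻¹) • (∑ a, σ a) := by
    rw [mixed, Matrix.smul_kronecker, one_kronecker_eq_blockHom]
    ext p q
    simp [blockHom_apply]
  have hRc : (((Fintype.card A : ℝ)⁻¹) • (∑ a, σ a)).IsHermitian := by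
    simp [Matrix.IsHermitian, Matrix.conjTranspose_smul, hR.eq]
  -- The scalar splits off the logarithm only on the support, because `Real.log 0 = 0`; the factor
  -- in front kills the kernel and makes the identity exact.
  have hlog : (∑ a, σ a) * matLog (((Fintype.card A : ℝ)⁻¹) • (∑ a, σ a)) =
      (∑ a, σ a) * matLog (∑ a, σ a) - Real.log (Fintype.card A) • (∑ a, σ a) := by
    obtain ⟨V, x, hx⟩ := exists_unitary_conj_diagonal hR
    have hc : ((Fintype.card A : ℝ)⁻¹) • (∑ a, σ a) = (V : Matrix E E ℂ) *
        Matrix.diagonal (fun i => (((Fintype.card A : ℝ)⁻¹ * x i : ℝ) : ℂ)) *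
          star (V : Matrix E E ℂ) := by
      conv_lhs => rw [hx]
      rw [← smul_mul_assoc, ← mul_smul_comm]
      congr 2
      ext i j
      by_cases h : i = j <;> simp [h, Matrix.diagonal]
    have hVV : star (V : Matrix E E ℂ) * V = 1 := Unitary.coe_star_mul_self V
    have key : ∀ d e : E → ℂ, (V : Matrix E E ℂ) * Matrix.diagonal d * star (V : Matrix E E ℂ) *
        ((V : Matrix E E ℂ) * Matrix.diagonal e * star (V : Matrix E E ℂ)) =
        (V : Matrix E E ℂ) * Matrix.diagonal (fun i => d i * e i) * star (V : Matrix E E ℂ) := by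
      intro d e
      calc _ = (V : Matrix E E ℂ) * Matrix.diagonal d * (star (V : Matrix E E ℂ) * V) *
            Matrix.diagonal e * star (V : Matrix E E ℂ) := by simp only [mul_assoc]
        _ = _ := by rw [hVV, mul_one, mul_assoc (V : Matrix E E ℂ), Matrix.diagonal_mul_diagonal]
    rw [matLog, matLog, hc, cfc_conj_diagonal, hx, cfc_conj_diagonal, key, key,
      ← smul_mul_assoc, ← mul_smul_comm, ← sub_mul, ← mul_sub]
    congr 2
    ext i j
    by_cases h : i = j
    · subst h
      have hcard : (Fintype.card A : ℝ) ≠ 0 := by exact_mod_cast Fintype.card_ne_zero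
      rcases eq_or_ne (x i) 0 with h0 | h0
      · simp [h0]
      · simp only [Matrix.diagonal_apply_eq, Matrix.sub_apply, Matrix.smul_apply,
          Complex.real_smul]
        rw [Real.log_mul (inv_ne_zero hcard) h0, Real.log_inv]
        push_cast
        ring
    · simp [h]
  rw [modMutualInfo, marginalE_blockHom, hmix, relEntropy, matLog, matLog, cfc_blockHom hσ,
    cfc_blockHom fun _ => hRc, ← map_sub, ← map_mul, trace_blockHom, Complex.re_sum]
  have : ∀ a, ((σ * ((fun a => cfc Real.log (σ a)) - fun _ =>
      cfc Real.log (((Fintype.card A : ℝ)⁻¹) • (∑ a, σ a))) : A → Matrix E E ℂ) a).trace.re =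
      (σ a * matLog (σ a)).trace.re -
        (σ a * matLog (((Fintype.card A : ℝ)⁻¹) • (∑ a, σ a))).trace.re := by
    intro a
    simp [mul_sub, matLog]
  rw [Finset.sum_congr rfl fun a _ => this a, Finset.sum_sub_distrib, ← Complex.re_sum (s := _)
    (f := fun a => (σ a * matLog (((Fintype.card A : ℝ)⁻¹) • (∑ a, σ a))).trace),
    ← Matrix.trace_sum, ← Finset.sum_mul, hlog]
  simp [htr, Complex.log_re]
  ring

end BlockDiagonal

/-! ### An eigenbasis of one Hermitian matrix adapted to a second one -/

section JointBasis

open Module.End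

/-- A symmetric operator `S` can be compressed to a subspace and diagonalized there. -/
lemma exists_orthonormalBasis_inner_eq_zero {V : Type*} [NormedAddCommGroup V]
    [InnerProductSpace ℂ V] [FiniteDimensional ℂ V] {S : V →ₗ[ℂ] V} (hS : S.IsSymmetric)
    (K : Submodule ℂ V) :
    ∃ v : OrthonormalBasis (Fin (Module.finrank ℂ K)) ℂ K,
      ∀ k l, k ≠ l → inner ℂ (v k : V) (S (v l)) = 0 := by
  -- The compression of `S` to `K` is symmetric even if `S` does not preserve `K`; its eigenbasis is
  -- the one sought.
  let C : K →ₗ[ℂ] K := (K.orthogonalProjectionOnto.toLinearMap ∘ₗ S) ∘ₗ K.subtype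
  have hCinner : ∀ u w : K, inner ℂ u (C w) = inner ℂ (u : V) (S w) := by
    intro u w
    simp [C]
  have hC : C.IsSymmetric := by
    intro u w
    rw [hCinner, ← inner_conj_symm, hCinner, inner_conj_symm]
    exact hS u w
  refine ⟨hC.eigenvectorBasis rfl, fun k l h => ?_⟩
  rw [← hCinner, LinearMap.IsSymmetric.apply_eigenvectorBasis, inner_smul_right,
    orthonormal_iff_ite.1 (OrthonormalBasis.orthonormal _), if_neg h, mul_zero]

/-- A symmetric operator `T` has an orthonormal eigenbasis in which another symmetric operator `S`
has no off-diagonal entries within the eigenspaces of `T`. -/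
lemma exists_eigenbasis_block_diagonal {n V : Type*} [Fintype n] [NormedAddCommGroup V]
    [InnerProductSpace ℂ V] [FiniteDimensional ℂ V] (hn : Module.finrank ℂ V = Fintype.card n)
    {T S : V →ₗ[ℂ] V} (hT : T.IsSymmetric) (hS : S.IsSymmetric) :
    ∃ (b : OrthonormalBasis n ℂ V) (r : n → ℝ), (∀ i, T (b i) = (r i : ℂ) • b i) ∧
      ∀ i j, i ≠ j → r i = r j → inner ℂ (b i) (S (b j)) = 0 := by
  classical
  have hv : ∀ μ : Eigenvalues T, ∃ v : OrthonormalBasis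
      (Fin (Module.finrank ℂ (eigenspace T μ.1))) ℂ (eigenspace T μ.1),
      ∀ k l, k ≠ l → inner ℂ (v k : V) (S (v l)) = 0 :=
    fun μ => exists_orthonormalBasis_inner_eq_zero hS _
  choose v hv using hv
  have hreal : ∀ μ : Eigenvalues T, ((μ.1.re : ℝ) : ℂ) = μ.1 := fun μ =>
    Complex.conj_eq_iff_re.1 (hT.conj_eigenvalue_eq_self μ.2)
  obtain ⟨b₀, hb₀⟩ : ∃ b₀ : OrthonormalBasis
      (Σ μ : Eigenvalues T, Fin (Module.finrank ℂ (eigenspace T μ.1))) ℂ V,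
      ∀ a, b₀ a = (v a.1 a.2 : V) := by
    refine ⟨hT.direct_sum_isInternal.collectedOrthonormalBasis hT.orthogonalFamily_eigenspaces' v,
      fun a => ?_⟩
    simp only [DirectSum.IsInternal.collectedOrthonormalBasis,
      Module.Basis.coe_toOrthonormalBasis, DirectSum.IsInternal.collectedBasis_coe]
    exact congrArg Subtype.val (congrFun (OrthonormalBasis.coe_toBasis (v a.1)) a.2)
  have hcard : Fintype.card (Σ μ : Eigenvalues T, Fin (Module.finrank ℂ (eigenspace T μ.1))) =
      Fintype.card n := by
    rw [← Module.finrank_eq_card_basis b₀.toBasis, hn]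
  let e := Fintype.equivOfCardEq hcard
  have hbij : ∀ i, b₀.reindex e i = b₀ (e.symm i) := fun i => by simp
  refine ⟨b₀.reindex e, fun i => (e.symm i).1.1.re, fun i => ?_, fun i j hij hr => ?_⟩
  · rw [hbij, hb₀, hreal]
    exact mem_eigenspace_iff.1 (Subtype.prop _)
  · have hne : e.symm i ≠ e.symm j := fun h => hij (e.symm.injective h)
    have hμ : (e.symm i).1 = (e.symm j).1 := Subtype.ext (by
      rw [← hreal, ← hreal (e.symm j).1]; exact congrArg _ hr)
    rw [hbij, hbij, hb₀, hb₀]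
    generalize e.symm i = p at hne hμ
    generalize e.symm j = q at hne hμ
    obtain ⟨μ, k⟩ := p
    obtain ⟨ν, l⟩ := q
    simp only at hμ
    subst hμ
    exact hv μ k l fun h => hne (by rw [h])

variable {n : Type*} [Fintype n] [DecidableEq n]

/-- A Hermitian matrix `R` has an orthonormal eigenbasis in which another Hermitian matrix `X` has
no off-diagonal entries within the eigenspaces of `R`. -/
lemma exists_unitary_diagonal_and_block_diagonal {R X : Matrix n n ℂ} (hR : R.IsHermitian)
    (hX : X.IsHermitian) :
    ∃ (U : Matrix.unitaryGroup n ℂ) (r : n → ℝ),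
      R = (U : Matrix n n ℂ) * Matrix.diagonal (fun i => (r i : ℂ)) * star (U : Matrix n n ℂ) ∧
      ∀ i j, i ≠ j → r i = r j →
        (star (U : Matrix n n ℂ) * X * (U : Matrix n n ℂ)) i j = 0 := by
  obtain ⟨b, r, hTb, hSb⟩ := exists_eigenbasis_block_diagonal (n := n) finrank_euclideanSpace
    (Matrix.isSymmetric_toEuclideanLin_iff.2 hR) (Matrix.isSymmetric_toEuclideanLin_iff.2 hX)
  let U : Matrix.unitaryGroup n ℂ :=
    ⟨_, (EuclideanSpace.basisFun n ℂ).toMatrix_orthonormalBasis_mem_unitary b⟩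
  have hU : ∀ i j, (U : Matrix n n ℂ) i j = b j i := fun i j => by
    simp [U, Module.Basis.toMatrix_apply]
  have hentry : ∀ (Y : Matrix n n ℂ) i j, (star (U : Matrix n n ℂ) * Y * (U : Matrix n n ℂ)) i j =
      inner ℂ (b i) (Matrix.toEuclideanLin Y (b j)) := by
    intro Y i j
    rw [mul_assoc, PiLp.inner_apply]
    simp [Matrix.mul_apply, Matrix.star_apply, hU, Matrix.toLpLin_apply, Matrix.mulVec, dotProduct,
      mul_comm]
  refine ⟨U, r, ?_, fun i j hij hr => by rw [hentry, hSb i j hij hr]⟩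
  have hD : star (U : Matrix n n ℂ) * R * (U : Matrix n n ℂ) =
      Matrix.diagonal fun i => (r i : ℂ) := by
    ext i j
    rw [hentry, hTb, inner_smul_right, orthonormal_iff_ite.1 b.orthonormal i j,
      Matrix.diagonal_apply]
    by_cases h : i = j
    · subst h; simp
    · simp [h]
  have hUU : (U : Matrix n n ℂ) * star (U : Matrix n n ℂ) = 1 := Unitary.coe_mul_star_self U
  rw [← hD]
  calc R = ((U : Matrix n n ℂ) * star (U : Matrix n n ℂ)) * R *
        ((U : Matrix n n ℂ) * star (U : Matrix n n ℂ)) := by rw [hUU, one_mul, mul_one]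
    _ = _ := by simp only [mul_assoc]

end JointBasis

/-! ### The pinching inequality and the number of eigenvalues -/

section Pinching

variable {n : Type*} [Fintype n] [DecidableEq n]

/-- The pinching inequality, in a basis in which the pinched matrix is diagonal. -/
lemma posSemidef_smul_diagonal_sub {X : Matrix n n ℂ} (hX : X.PosSemidef) (r : n → ℝ)
    (h : ∀ i j, i ≠ j → r i = r j → X i j = 0) :
    (((Finset.univ.image r).card : ℂ) • Matrix.diagonal (fun i => X i i) - X).PosSemidef := by
  set s := Finset.univ.image r with hs
  let Q : ℝ → Matrix n n ℂ := fun k => Matrix.diagonal fun i => if r i = k then 1 else 0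
  have hQ : ∀ k, (Q k).conjTranspose = Q k := fun k => by
    rw [Matrix.diagonal_conjTranspose]
    congr 1
    ext i
    by_cases h : r i = k <;> simp [h]
  -- With `Q k` the spectral projections, expanding this manifestly positive double sum gives twice
  -- the pinching gap; the number of projections appears as the constant.
  have hsum : (∑ k ∈ s, ∑ l ∈ s, (Q k - Q l) * X * (Q k - Q l)) =
      (2 : ℂ) • ((s.card : ℂ) • Matrix.diagonal (fun i => X i i) - X) := by
    have h1 : ∑ k ∈ s, Q k = 1 := by
      ext i j
      rw [Matrix.sum_apply]
      by_cases hij : i = j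
      · subst hij
        simp [Q, hs]
      · simp [Q, hij]
    have h2 : ∑ k ∈ s, Q k * X * Q k = Matrix.diagonal (fun i => X i i) := by
      ext i j
      rw [Matrix.sum_apply]
      simp only [Q, Matrix.diagonal_mul, Matrix.mul_diagonal]
      by_cases hij : i = j
      · subst hij
        simp [hs]
      · rw [Matrix.diagonal_apply_ne _ hij]
        refine Finset.sum_eq_zero fun k _ => ?_
        by_cases h1 : r i = k
        · by_cases h2 : r j = k
          · simp [h i j hij (h1.trans h2.symm)]
          · simp [h2]
        · simp [h1]
    have h3 : ∀ k l, (Q k - Q l) * X * (Q k - Q l) =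
        Q k * X * Q k + Q l * X * Q l - Q k * X * Q l - Q l * X * Q k := fun k l => by noncomm_ring
    have h4 : ∑ k ∈ s, ∑ l ∈ s, Q k * X * Q l = X := by
      simp_rw [← Finset.mul_sum, ← Finset.sum_mul, h1, one_mul, mul_one]
    have h5 : ∑ k ∈ s, ∑ l ∈ s, Q l * X * Q k = X := by rw [Finset.sum_comm, h4]
    simp_rw [h3, Finset.sum_sub_distrib, Finset.sum_add_distrib, Finset.sum_const, h4, h5,
      ← Finset.smul_sum, h2]
    module
  have hpos : (∑ k ∈ s, ∑ l ∈ s, (Q k - Q l) * X * (Q k - Q l)).PosSemidef := by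
    refine Matrix.posSemidef_sum _ fun k _ => Matrix.posSemidef_sum _ fun l _ => ?_
    simpa [hQ] using hX.mul_mul_conjTranspose_same (Q k - Q l)
  rw [hsum] at hpos
  have := hpos.smul (a := (2⁻¹ : ℂ)) (inv_nonneg.2 zero_le_two)
  rwa [smul_smul, inv_mul_cancel₀ two_ne_zero, one_smul] at this

lemma numEigenvalues_conj_diagonal (U : Matrix.unitaryGroup n ℂ) (r : n → ℝ) :
    numEigenvalues ((U : Matrix n n ℂ) * Matrix.diagonal (fun i => (r i : ℂ)) *
      star (U : Matrix n n ℂ)) = (Finset.univ.image r).card := by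
  have h1 : spectrum ℂ ((U : Matrix n n ℂ) * Matrix.diagonal (fun i => (r i : ℂ)) *
      star (U : Matrix n n ℂ)) = Complex.ofReal '' (Finset.univ.image r : Finset ℝ) := by
    rw [Unitary.spectrum_star_right_conjugate, spectrum_diagonal]
    ext z
    simp
  rw [numEigenvalues, h1, Set.ncard_image_of_injective _ Complex.ofReal_injective,
    Set.ncard_coe_finset]

end Pinching

/-! ### Trace inequalities: Jensen for diagonal entries, and the operator logarithm -/

section Trace

variable {n : Type*} [Fintype n] [DecidableEq n]

lemma trace_mul_conj_diagonal (X U : Matrix n n ℂ) (d : n → ℂ) :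
    (X * (U * Matrix.diagonal d * star U)).trace = ∑ j, (star U * X * U) j j * d j := by
  rw [← mul_assoc, Matrix.trace_mul_comm, ← mul_assoc, ← mul_assoc]
  simp [Matrix.trace, Matrix.mul_diagonal]

lemma re_trace_mul_conj_diagonal (X U : Matrix n n ℂ) (d : n → ℝ) :
    (X * (U * Matrix.diagonal (fun i => (d i : ℂ)) * star U)).trace.re =
      ∑ j, ((star U * X * U) j j).re * d j := by
  rw [trace_mul_conj_diagonal, Complex.re_sum]
  simp

lemma posSemidef_star_mul_mul {X : Matrix n n ℂ} (hX : X.PosSemidef) (U : Matrix n n ℂ) :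
    (star U * X * U).PosSemidef :=
  hX.conjTranspose_mul_mul_same U

lemma re_diag_nonneg {X : Matrix n n ℂ} (hX : X.PosSemidef) (i : n) : 0 ≤ (X i i).re :=
  (Complex.le_def.1 (hX.diag_nonneg (i := i))).1

lemma ofReal_re_diag {X : Matrix n n ℂ} (hX : X.IsHermitian) (i : n) :
    ((X i i).re : ℂ) = X i i :=
  Complex.conj_eq_iff_re.1 (hX.apply i i)

lemma star_mul_conj_mul (U : Matrix.unitaryGroup n ℂ) (X : Matrix n n ℂ) :
    star (U : Matrix n n ℂ) * ((U : Matrix n n ℂ) * X * star (U : Matrix n n ℂ)) * U = X := by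
  have hUU : star (U : Matrix n n ℂ) * U = 1 := Unitary.coe_star_mul_self U
  calc _ = (star (U : Matrix n n ℂ) * U) * X * (star (U : Matrix n n ℂ) * U) := by
        simp only [mul_assoc]
    _ = X := by rw [hUU, one_mul, mul_one]

lemma conj_star_mul_mul (U : Matrix.unitaryGroup n ℂ) (X : Matrix n n ℂ) :
    (U : Matrix n n ℂ) * (star (U : Matrix n n ℂ) * X * U) * star (U : Matrix n n ℂ) = X := by
  have hUU : (U : Matrix n n ℂ) * star (U : Matrix n n ℂ) = 1 := Unitary.coe_mul_star_self U
  calc _ = ((U : Matrix n n ℂ) * star (U : Matrix n n ℂ)) * X *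
        ((U : Matrix n n ℂ) * star (U : Matrix n n ℂ)) := by simp only [mul_assoc]
    _ = X := by rw [hUU, one_mul, mul_one]

lemma exists_unitary_conj_diagonal_nonneg {X : Matrix n n ℂ} (hX : X.PosSemidef) :
    ∃ (V : Matrix.unitaryGroup n ℂ) (x : n → ℝ), (∀ i, 0 ≤ x i) ∧ X = (V : Matrix n n ℂ) *
      Matrix.diagonal (fun i => (x i : ℂ)) * star (V : Matrix n n ℂ) := by
  obtain ⟨V, x, h⟩ := exists_unitary_conj_diagonal hX.isHermitian
  refine ⟨V, x, fun i => ?_, h⟩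
  have := re_diag_nonneg (posSemidef_star_mul_mul hX (V : Matrix n n ℂ)) i
  rw [h, star_mul_conj_mul] at this
  simpa using this

lemma re_trace_mul_nonneg {X C : Matrix n n ℂ} (hX : X.PosSemidef) (hC : C.PosSemidef) :
    0 ≤ (X * C).trace.re := by
  obtain ⟨V, c, hc, rfl⟩ := exists_unitary_conj_diagonal_nonneg hC
  rw [re_trace_mul_conj_diagonal]
  exact Finset.sum_nonneg fun j _ =>
    mul_nonneg (re_diag_nonneg (posSemidef_star_mul_mul hX _) j) (hc j)

lemma re_trace_mul_le {X B C : Matrix n n ℂ} (hX : X.PosSemidef) (h : (C - B).PosSemidef) :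
    (X * B).trace.re ≤ (X * C).trace.re := by
  have := re_trace_mul_nonneg hX h
  rw [mul_sub, Matrix.trace_sub, Complex.sub_re] at this
  linarith

/-- In a unit vector, a positive semidefinite matrix has a spectral measure. -/
lemma exists_weights_conj_cfc {X : Matrix n n ℂ} (hX : X.PosSemidef)
    (U : Matrix.unitaryGroup n ℂ) (j : n) :
    ∃ w x : n → ℝ, (∀ k, 0 ≤ w k) ∧ ∑ k, w k = 1 ∧ (∀ k, 0 ≤ x k) ∧
      ((star (U : Matrix n n ℂ) * X * U) j j).re = ∑ k, w k * x k ∧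
      ∀ f : ℝ → ℝ, ((star (U : Matrix n n ℂ) * cfc f X * U) j j).re = ∑ k, w k * f (x k) := by
  obtain ⟨V, x, hx, hXV⟩ := exists_unitary_conj_diagonal_nonneg hX
  set W : Matrix n n ℂ := star (U : Matrix n n ℂ) * V with hW
  have hWW : W * star W = 1 := by
    have h1 : (V : Matrix n n ℂ) * star (V : Matrix n n ℂ) = 1 := Unitary.coe_mul_star_self V
    have h2 : star (U : Matrix n n ℂ) * U = 1 := Unitary.coe_star_mul_self U
    calc W * star W = star (U : Matrix n n ℂ) * (V * star (V : Matrix n n ℂ)) * U := by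
          simp only [hW, star_mul, star_star, mul_assoc]
      _ = 1 := by rw [h1, mul_one, h2]
  have hval : ∀ d : n → ℝ, ((star (U : Matrix n n ℂ) * ((V : Matrix n n ℂ) *
      Matrix.diagonal (fun i => (d i : ℂ)) * star (V : Matrix n n ℂ)) * U) j j).re =
      ∑ k, Complex.normSq (W j k) * d k := by
    intro d
    have : star (U : Matrix n n ℂ) * ((V : Matrix n n ℂ) *
      Matrix.diagonal (fun i => (d i : ℂ)) * star (V : Matrix n n ℂ)) * U =
      W * Matrix.diagonal (fun i => (d i : ℂ)) * star W := by
      simp only [hW, star_mul, star_star, mul_assoc]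
    rw [this, Matrix.mul_apply, Complex.re_sum]
    refine Finset.sum_congr rfl fun k _ => ?_
    rw [Matrix.mul_diagonal, Matrix.star_apply, mul_right_comm, Complex.star_def, Complex.mul_conj,
      ← Complex.ofReal_mul, Complex.ofReal_re]
  refine ⟨fun k => Complex.normSq (W j k), x, fun k => Complex.normSq_nonneg _, ?_, hx, ?_, ?_⟩
  · have h := congrArg Complex.re (congrFun (congrFun hWW j) j)
    rw [Matrix.mul_apply, Complex.re_sum] at h
    simpa [Matrix.star_apply, Complex.normSq_apply] using h
  · conv_lhs => rw [hXV]
    exact hval x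
  · intro f
    conv_lhs => rw [hXV]
    rw [cfc_conj_diagonal, hval]

/-- Jensen for t ↦ t^p under the spectral measure of `X` at column `j` of `U`. It ensures that
passing to diagonal entries does not increase the Rényi trace. -/
lemma rpow_diag_le {X : Matrix n n ℂ} (hX : X.PosSemidef) (U : Matrix.unitaryGroup n ℂ) (j : n)
    {p : ℝ} (hp : 1 ≤ p) :
    ((star (U : Matrix n n ℂ) * X * U) j j).re ^ p ≤
      ((star (U : Matrix n n ℂ) * matPow X p * U) j j).re := by
  obtain ⟨w, x, hw, hw1, hx, h1, h2⟩ := exists_weights_conj_cfc hX U j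
  rw [h1, matPow, h2]
  exact Real.rpow_arith_mean_le_arith_mean_rpow _ w x (fun k _ => hw k) hw1 (fun k _ => hx k) hp

/-- Shifting by ε makes the argument strictly positive, as operator concavity and monotonicity of
the logarithm require. Zero eigenvalues contribute nothing to either side, and elsewhere the scalar
logarithm increases. -/
lemma re_trace_mul_matLog_le {X : Matrix n n ℂ} (hX : X.PosSemidef) {ε : ℝ} (hε : 0 < ε) :
    (X * matLog X).trace.re ≤ (X * matLog (X + ε • 1)).trace.re := by
  obtain ⟨V, x, hx, hXV⟩ := exists_unitary_conj_diagonal_nonneg hX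
  have hε' : X + ε • 1 = (V : Matrix n n ℂ) *
      Matrix.diagonal (fun i => ((x i + ε : ℝ) : ℂ)) * star (V : Matrix n n ℂ) := by
    have h1 : (V : Matrix n n ℂ) * star (V : Matrix n n ℂ) = 1 := Unitary.coe_mul_star_self V
    have h2 : Matrix.diagonal (fun i => ((x i + ε : ℝ) : ℂ)) =
        Matrix.diagonal (fun i => (x i : ℂ)) + ε • 1 := by
      ext i j
      by_cases h : i = j <;> simp [h, Matrix.diagonal]
    rw [h2, mul_add, add_mul, ← hXV, mul_smul_comm, smul_mul_assoc, mul_one, h1]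
  have hd : ∀ i, ((star (V : Matrix n n ℂ) * X * V) i i).re = x i := fun i => by
    rw [hXV, star_mul_conj_mul]; simp
  rw [hε']
  conv_lhs => rw [hXV, matLog, cfc_conj_diagonal, ← hXV]
  rw [matLog, cfc_conj_diagonal, re_trace_mul_conj_diagonal, re_trace_mul_conj_diagonal]
  refine Finset.sum_le_sum fun i _ => ?_
  rw [hd]
  rcases (hx i).eq_or_lt with h | h
  · simp [← h]
  · exact mul_le_mul_of_nonneg_left (Real.log_le_log h (by linarith)) h.le

open scoped MatrixOrder Matrix.Norms.L2Operator in
/-- Operator concavity and monotonicity of the logarithm, traced against a positive matrix. -/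
lemma sum_re_trace_mul_matLog_le {Ω : Type*} [Fintype Ω] [Nonempty Ω] {X B : Matrix n n ℂ}
    (hX : X.PosSemidef) {σ : Ω → Matrix n n ℂ} (hσ : ∀ ω, (σ ω).PosSemidef)
    (hB : (B - (Fintype.card Ω : ℝ)⁻¹ • ∑ ω, σ ω).PosSemidef) {ε : ℝ} (hε : 0 < ε) :
    (Fintype.card Ω : ℝ)⁻¹ * ∑ ω, (X * matLog (σ ω + ε • 1)).trace.re ≤
      (X * matLog (B + ε • 1)).trace.re := by
  have hN : (Fintype.card Ω : ℝ) ≠ 0 := by exact_mod_cast Fintype.card_ne_zero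
  have hpos : ∀ Y : Matrix n n ℂ, Y.PosSemidef → IsStrictlyPositive (Y + ε • 1) := by
    intro Y hY
    rw [Matrix.isStrictlyPositive_iff_posDef]
    refine Matrix.PosDef.posSemidef_add hY ?_
    exact Matrix.PosDef.one.smul hε
  have h1 := CFC.concaveOn_log (A := Matrix n n ℂ) |>.le_map_sum (t := Finset.univ)
    (w := fun _ : Ω => (Fintype.card Ω : ℝ)⁻¹) (p := fun ω => σ ω + ε • 1)
    (fun _ _ => by positivity) (by simp [hN]) (fun ω _ => hpos _ (hσ ω))
  have hmean : ∑ ω, (Fintype.card Ω : ℝ)⁻¹ • (σ ω + ε • 1) =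
      (Fintype.card Ω : ℝ)⁻¹ • ∑ ω, σ ω + ε • (1 : Matrix n n ℂ) := by
    rw [← Finset.smul_sum, Finset.sum_add_distrib, smul_add, Finset.sum_const, Finset.card_univ,
      ← Nat.cast_smul_eq_nsmul ℝ, smul_smul, inv_mul_cancel₀ hN, one_smul]
  rw [hmean] at h1
  have hmeanpos : ((Fintype.card Ω : ℝ)⁻¹ • ∑ ω, σ ω).PosSemidef :=
    (Matrix.posSemidef_sum _ fun ω _ => hσ ω).smul (by positivity)
  have h2 := CFC.log_le_log (a := (Fintype.card Ω : ℝ)⁻¹ • ∑ ω, σ ω + ε • (1 : Matrix n n ℂ))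
    (b := B + ε • 1) (by rw [Matrix.le_iff]; simpa using hB) (hpos _ hmeanpos)
  have h3 := re_trace_mul_le hX (Matrix.le_iff.1 (h1.trans h2))
  refine le_trans (le_of_eq ?_) h3
  rw [← Finset.smul_sum, mul_smul_comm, Matrix.trace_smul, Complex.smul_re,
    Finset.mul_sum _ _ X, Matrix.trace_sum, Complex.re_sum]
  rfl

end Trace

/-! ### Averaging over a uniformly random hash function -/

section Averaging

variable {A E : Type*} [Fintype A] [DecidableEq A] [Fintype E] [DecidableEq E] {M : ℕ}

/-- Two distinct points collide under a uniformly random function with probability `1 / M`. -/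
lemma card_collision_mul (hM : 1 ≤ M) {a b : A} (hab : b ≠ a) :
    M * (Finset.univ.filter fun f : A → Fin M => f b = f a).card = Fintype.card (A → Fin M) := by
  have : NeZero M := ⟨by omega⟩
  -- Shifting only the value at `b` permutes the functions, so the difference f a - f b is uniformly
  -- distributed.
  have hshift : ∀ c : Fin M, (Finset.univ.filter fun f : A → Fin M => f b + c = f a).card =
      (Finset.univ.filter fun f : A → Fin M => f b = f a).card := by
    intro c
    let e : (A → Fin M) ≃ (A → Fin M) :=
      Equiv.piCongrRight fun x => if x = b then Equiv.addRight c else Equiv.refl _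
    refine Finset.card_equiv e fun f => ?_
    simp [e, hab.symm]
  calc M * (Finset.univ.filter fun f : A → Fin M => f b = f a).card
      = ∑ c : Fin M, (Finset.univ.filter fun f : A → Fin M => f b + c = f a).card := by
        simp [hshift]
    _ = ∑ f : A → Fin M, (Finset.univ.filter fun c : Fin M => f b + c = f a).card := by
        simp_rw [Finset.card_filter]
        exact Finset.sum_comm
    _ = ∑ f : A → Fin M, 1 := by
        refine Finset.sum_congr rfl fun f _ => ?_
        rw [Finset.card_eq_one]
        exact ⟨f a - f b, by ext c; simp [eq_sub_iff_add_eq, add_comm]⟩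
    _ = _ := by simp

/-- The point `a` lies in its own fiber with certainty, every other point with probability 1/M. -/
lemma average_hash_fiber (hM : 1 ≤ M) (X : A → Matrix E E ℂ) (a : A) :
    (Fintype.card (A → Fin M) : ℝ)⁻¹ • ∑ f : A → Fin M, ∑ b with f b = f a, X b =
      X a + (M : ℝ)⁻¹ • (∑ b, X b - X a) := by
  have : NeZero M := ⟨by omega⟩
  have hN : (Fintype.card (A → Fin M) : ℝ) ≠ 0 := by exact_mod_cast Fintype.card_ne_zero
  have h1 : ∑ f : A → Fin M, ∑ b with f b = f a, X b =
      ∑ b, ((Finset.univ.filter fun f : A → Fin M => f b = f a).card : ℝ) • X b := by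
    simp_rw [Finset.sum_filter]
    rw [Finset.sum_comm]
    refine Finset.sum_congr rfl fun b _ => ?_
    rw [← Finset.sum_filter, Finset.sum_const, Nat.cast_smul_eq_nsmul]
  rw [h1, Finset.smul_sum, ← Finset.add_sum_erase _ _ (Finset.mem_univ a),
    ← Finset.add_sum_erase Finset.univ X (Finset.mem_univ a), add_sub_cancel_left, Finset.smul_sum]
  congr 1
  · rw [smul_smul]
    simp
  · refine Finset.sum_congr rfl fun b hb => ?_
    have h := card_collision_mul hM (Finset.ne_of_mem_erase hb)
    rw [smul_smul]
    congr 1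
    rw [← h]
    have h2 : ((Finset.univ.filter fun f : A → Fin M => f b = f a).card : ℝ) ≠ 0 := by
      intro h0
      rw [← h] at hN
      push_cast at hN
      exact hN (by rw [h0, mul_zero])
    push_cast
    field_simp

/-- The entropy sum of a random hash, averaged over all functions, is bounded by a quantity
that only involves the diagonal entries of each `X a` in a pinched eigenbasis of `∑ a, X a`. -/
lemma exists_hash_entropy_le (hM : 1 ≤ M) {X : A → Matrix E E ℂ} (hX : ∀ a, (X a).PosSemidef)
    (v : ℝ) (U : A → Matrix.unitaryGroup E ℂ) (r y : A → E → ℝ)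
    (hy : ∀ a j, y a j = ((star (U a : Matrix E E ℂ) * X a * U a) j j).re)
    (hR : ∀ a, ∑ b, X b = (U a : Matrix E E ℂ) * Matrix.diagonal (fun i => (r a i : ℂ)) *
      star (U a : Matrix E E ℂ))
    (hv : ∀ a, (Matrix.diagonal (fun i => ((v * y a i : ℝ) : ℂ)) -
      star (U a : Matrix E E ℂ) * X a * U a).PosSemidef)
    (hr : ∀ a j, 0 ≤ r a j) (hv1 : 0 < v) :
    ∃ f : A → Fin M, ∑ i, ((∑ a with f a = i, X a) * matLog (∑ a with f a = i, X a)).trace.re ≤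
      ∑ a, ∑ j, y a j * Real.log (v * y a j + r a j / M) := by
  have : NeZero M := ⟨by omega⟩
  have hN : (0 : ℝ) < Fintype.card (A → Fin M) := by exact_mod_cast Fintype.card_pos
  have hy0 : ∀ a j, 0 ≤ y a j := fun a j => by
    rw [hy]; exact re_diag_nonneg (posSemidef_star_mul_mul (hX a) _) j
  let σ : (A → Fin M) → Fin M → Matrix E E ℂ := fun f i => ∑ a with f a = i, X a
  have hσ : ∀ f i, (σ f i).PosSemidef := fun f i => Matrix.posSemidef_sum _ fun a _ => hX a
  have hε : ∀ ε : ℝ, 0 < ε → (Fintype.card (A → Fin M) : ℝ)⁻¹ *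
      ∑ f, ∑ i, (σ f i * matLog (σ f i)).trace.re ≤
      ∑ a, ∑ j, y a j * Real.log (v * y a j + r a j / M + ε) := by
    intro ε hε
    have h1 : ∀ f, ∑ i, (σ f i * matLog (σ f i)).trace.re ≤
        ∑ a, (X a * matLog (σ f (f a) + ε • 1)).trace.re := by
      intro f
      calc ∑ i, (σ f i * matLog (σ f i)).trace.re
          ≤ ∑ i, (σ f i * matLog (σ f i + ε • 1)).trace.re :=
            Finset.sum_le_sum (f := fun i => (σ f i * matLog (σ f i)).trace.re)
              (g := fun i => (σ f i * matLog (σ f i + ε • 1)).trace.re)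
              fun i _ => re_trace_mul_matLog_le (hσ f i) hε
        _ = ∑ i, ∑ a with f a = i, (X a * matLog (σ f (f a) + ε • 1)).trace.re := by
            refine Finset.sum_congr rfl fun i _ => ?_
            nth_rewrite 1 [show σ f i = ∑ a with f a = i, X a from rfl]
            rw [Finset.sum_mul, Matrix.trace_sum, Complex.re_sum]
            refine Finset.sum_congr rfl fun a ha => ?_
            rw [(Finset.mem_filter.1 ha).2]
        _ = _ := Finset.sum_fiberwise _ _ _
    have h2 : ∀ a, (Fintype.card (A → Fin M) : ℝ)⁻¹ *
        ∑ f : A → Fin M, (X a * matLog (σ f (f a) + ε • 1)).trace.re ≤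
        ∑ j, y a j * Real.log (v * y a j + r a j / M + ε) := by
      intro a
      set B : Matrix E E ℂ := (U a : Matrix E E ℂ) *
        Matrix.diagonal (fun i => ((v * y a i + r a i / M : ℝ) : ℂ)) *
          star (U a : Matrix E E ℂ) with hBdef
      -- The gap is the conjugated pinching gap plus the term X_a/M that `B` neglects, both
      -- positive.
      have hB1 : B - (X a + (M : ℝ)⁻¹ • (∑ b, X b - X a)) = (U a : Matrix E E ℂ) *
          (Matrix.diagonal (fun i => ((v * y a i : ℝ) : ℂ)) -
            star (U a : Matrix E E ℂ) * X a * U a) * star (U a : Matrix E E ℂ) +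
          (M : ℝ)⁻¹ • X a := by
        have hd : Matrix.diagonal (fun i => ((v * y a i + r a i / M : ℝ) : ℂ)) =
            Matrix.diagonal (fun i => ((v * y a i : ℝ) : ℂ)) +
              (M : ℝ)⁻¹ • Matrix.diagonal (fun i => (r a i : ℂ)) := by
          ext i j
          by_cases h : i = j
          · subst h; simp; ring
          · simp [h]
        rw [hBdef, hd, mul_add, add_mul, mul_smul_comm, smul_mul_assoc, ← hR, mul_sub, sub_mul,
          conj_star_mul_mul, smul_sub]
        abel
      have hB : (B - (Fintype.card (A → Fin M) : ℝ)⁻¹ • ∑ f, σ f (f a)).PosSemidef := by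
        simp only [σ]
        rw [average_hash_fiber hM, hB1]
        refine Matrix.PosSemidef.add ?_ ((hX a).smul (by positivity))
        simpa using posSemidef_star_mul_mul (hv a) (star (U a : Matrix E E ℂ))
      have hBε : B + ε • 1 = (U a : Matrix E E ℂ) *
          Matrix.diagonal (fun i => ((v * y a i + r a i / M + ε : ℝ) : ℂ)) *
            star (U a : Matrix E E ℂ) := by
        have h1 : (U a : Matrix E E ℂ) * star (U a : Matrix E E ℂ) = 1 :=
          Unitary.coe_mul_star_self (U a)
        have h2 : Matrix.diagonal (fun i => ((v * y a i + r a i / M + ε : ℝ) : ℂ)) =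
            Matrix.diagonal (fun i => ((v * y a i + r a i / M : ℝ) : ℂ)) + ε • 1 := by
          ext i j
          by_cases h : i = j <;> simp [h]
        rw [h2, mul_add, add_mul, ← hBdef, mul_smul_comm, smul_mul_assoc, mul_one, h1]
      have h3 := sum_re_trace_mul_matLog_le (hX a) (fun f => hσ f (f a)) hB hε
      refine h3.trans (le_of_eq ?_)
      rw [hBε, matLog, cfc_conj_diagonal, re_trace_mul_conj_diagonal]
      simp only [hy]
    calc _ ≤ (Fintype.card (A → Fin M) : ℝ)⁻¹ *
          ∑ f : A → Fin M, ∑ a, (X a * matLog (σ f (f a) + ε • 1)).trace.re :=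
          mul_le_mul_of_nonneg_left (Finset.sum_le_sum fun f _ => h1 f) (by positivity)
      _ = ∑ a, (Fintype.card (A → Fin M) : ℝ)⁻¹ *
          ∑ f : A → Fin M, (X a * matLog (σ f (f a) + ε • 1)).trace.re := by
          rw [Finset.sum_comm, Finset.mul_sum]
      _ ≤ _ := Finset.sum_le_sum fun a _ => h2 a
  -- Removing ε is harmless: a term with `y a j = 0` vanishes, and otherwise the argument of the
  -- logarithm stays positive at ε = 0.
  have hlim : Filter.Tendsto (fun ε : ℝ => ∑ a, ∑ j,
      y a j * Real.log (v * y a j + r a j / M + ε)) (nhdsWithin 0 (Set.Ioi 0))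
      (nhds (∑ a, ∑ j, y a j * Real.log (v * y a j + r a j / M))) := by
    refine tendsto_finsetSum _ fun a _ => tendsto_finsetSum _ fun j _ => ?_
    rcases (hy0 a j).eq_or_lt with h | h
    · simp [← h]
    · have hne : v * y a j + r a j / M + 0 ≠ 0 := by
        have := hr a j
        positivity
      have hc : ContinuousAt (fun ε : ℝ => y a j * Real.log (v * y a j + r a j / M + ε)) 0 := by
        fun_prop (disch := exact hne)
      have := hc.tendsto
      simp only [add_zero] at this
      exact this.mono_left nhdsWithin_le_nhds
  have hmean := ge_of_tendsto hlim (eventually_nhdsWithin_of_forall fun ε h => hε ε h)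
  obtain ⟨f, -, hf⟩ := Finset.exists_le_of_sum_le (s := (Finset.univ : Finset (A → Fin M)))
    (f := fun f => ∑ i, (σ f i * matLog (σ f i)).trace.re)
    (g := fun _ => ∑ a, ∑ j, y a j * Real.log (v * y a j + r a j / M)) Finset.univ_nonempty (by
      rw [Finset.sum_const, Finset.card_univ, nsmul_eq_mul]
      rwa [inv_mul_le_iff₀ hN] at hmean)
  exact ⟨f, hf⟩

end Averaging

/-! ### The scalar inequality with the Rényi exponent -/

section Scalar

/-- Subadditivity of t ↦ t^s for 0 < s ≤ 1 gives (1+x)^s ≤ 1+x^s. -/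
lemma log_one_add_le {x s : ℝ} (hx : 0 ≤ x) (hs : 0 < s) (hs1 : s ≤ 1) :
    Real.log (1 + x) ≤ (1 / s) * Real.log (1 + x ^ s) := by
  have h := Real.rpow_add_le_add_rpow zero_le_one hx hs.le hs1
  rw [Real.one_rpow] at h
  have h2 := Real.log_le_log (by positivity) h
  rw [Real.log_rpow (by positivity)] at h2
  rw [one_div, le_inv_mul_iff₀ hs]
  exact h2

/-- The classical part of the bound. -/
lemma sum_mul_log_le {ι : Type*} [Fintype ι] {y r : ι → ℝ} (hy : ∀ i, 0 ≤ y i)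
    (hyr : ∀ i, y i ≤ r i) (hsum : ∑ i, y i = 1) {v m s T : ℝ} (hv : 1 ≤ v) (hm : 0 < m)
    (hs : 0 < s) (hs1 : s ≤ 1) (hT : ∑ i, y i ^ (1 + s) * r i ^ (-s) ≤ T) :
    Real.log m + ∑ i, y i * Real.log (v * y i + r i / m) - ∑ i, y i * Real.log (r i) ≤
      Real.log v + Real.log 2 / s + max 0 (Real.log m - (-1 / s) * Real.log T) := by
  have hv0 : 0 < v := by linarith
  have hterm : ∀ i, y i * Real.log m + y i * Real.log (v * y i + r i / m) -
      y i * Real.log (r i) ≤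
      y i * Real.log v + (1 / s) * (y i * Real.log (1 + (m * (y i / r i)) ^ s)) := by
    intro i
    rcases (hy i).eq_or_lt with h | h
    · simp [← h]
    · have hr : 0 < r i := h.trans_le (hyr i)
      -- As v ≥ 1, it can be factored out of both summands, which is where log v comes from.
      have h1 : Real.log (v * y i + r i / m) ≤ Real.log (v * (y i + r i / m)) := by
        refine Real.log_le_log (by positivity) ?_
        have : r i / m ≤ v * (r i / m) := le_mul_of_one_le_left (by positivity) hv
        linarith
      have h2 : v * (y i + r i / m) = v * ((r i / m) * (1 + m * (y i / r i))) := by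
        field_simp
        ring
      rw [h2, Real.log_mul (by positivity) (by positivity),
        Real.log_mul (by positivity) (by positivity), Real.log_div hr.ne' hm.ne'] at h1
      have h3 := log_one_add_le (x := m * (y i / r i)) (by positivity) hs hs1
      have h4 : Real.log m + Real.log (v * y i + r i / m) - Real.log (r i) ≤
          Real.log v + (1 / s) * Real.log (1 + (m * (y i / r i)) ^ s) := by linarith
      have h5 := mul_le_mul_of_nonneg_left h4 h.le
      linarith
  have hbase : ∀ i, 0 ≤ m * (y i / r i) := fun i =>
    mul_nonneg hm.le (div_nonneg (hy i) ((hy i).trans (hyr i)))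
  have hjensen : ∑ i, y i * Real.log (1 + (m * (y i / r i)) ^ s) ≤
      Real.log (∑ i, y i * (1 + (m * (y i / r i)) ^ s)) := by
    have := strictConcaveOn_log_Ioi.concaveOn.le_map_sum (t := Finset.univ) (w := y)
      (p := fun i => 1 + (m * (y i / r i)) ^ s) (fun i _ => hy i) hsum
      (fun i _ => by
        have := Real.rpow_nonneg (hbase i) s
        show (0 : ℝ) < _
        linarith)
    simpa using this
  have hsumle : ∑ i, y i * (1 + (m * (y i / r i)) ^ s) =
      1 + m ^ s * ∑ i, y i ^ (1 + s) * r i ^ (-s) := by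
    simp_rw [mul_add, mul_one, Finset.sum_add_distrib, hsum, Finset.mul_sum]
    congr 1
    refine Finset.sum_congr rfl fun i _ => ?_
    rcases (hy i).eq_or_lt with h | h
    · rw [← h, Real.zero_rpow (by linarith)]; simp
    · have hr : 0 < r i := h.trans_le (hyr i)
      rw [Real.mul_rpow hm.le (by positivity), Real.div_rpow h.le hr.le, Real.rpow_add h,
        Real.rpow_one, Real.rpow_neg hr.le]
      ring
  have hTpos : 0 < T := by
    refine lt_of_lt_of_le ?_ hT
    obtain ⟨i, hi⟩ : ∃ i, 0 < y i := by
      by_contra! hcon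
      have : ∑ i, y i ≤ 0 := Finset.sum_nonpos fun i _ => hcon i
      linarith
    refine Finset.sum_pos' (fun j _ => mul_nonneg (Real.rpow_nonneg (hy j) _)
      (Real.rpow_nonneg ((hy j).trans (hyr j)) _)) ⟨i, Finset.mem_univ i, ?_⟩
    exact mul_pos (Real.rpow_pos_of_pos hi _) (Real.rpow_pos_of_pos (hi.trans_le (hyr i)) _)
  have hSnonneg : 0 ≤ ∑ i, y i ^ (1 + s) * r i ^ (-s) := Finset.sum_nonneg fun j _ =>
    mul_nonneg (Real.rpow_nonneg (hy j) _) (Real.rpow_nonneg ((hy j).trans (hyr j)) _)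
  have hms : 0 < m ^ s := Real.rpow_pos_of_pos hm s
  have hlogle : Real.log (1 + m ^ s * ∑ i, y i ^ (1 + s) * r i ^ (-s)) ≤
      Real.log 2 + max 0 (s * Real.log m + Real.log T) := by
    -- Bounding a sum by twice the maximum produces the log 2 / s term and the max with 0.
    have h1 : 1 + m ^ s * ∑ i, y i ^ (1 + s) * r i ^ (-s) ≤ 2 * max 1 (m ^ s * T) := by
      have h2 := mul_le_mul_of_nonneg_left hT hms.le
      have h3 := le_max_left 1 (m ^ s * T)
      have h4 := le_max_right 1 (m ^ s * T)
      linarith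
    refine (Real.log_le_log (by positivity) h1).trans ?_
    rw [Real.log_mul two_ne_zero (by positivity)]
    gcongr
    rcases le_total 1 (m ^ s * T) with h | h
    · rw [max_eq_right h, Real.log_mul hms.ne' hTpos.ne', Real.log_rpow hm]
      exact le_max_right _ _
    · rw [max_eq_left h, Real.log_one]
      exact le_max_left _ _
  have hmain := Finset.sum_le_sum fun i (_ : i ∈ Finset.univ) => hterm i
  rw [Finset.sum_sub_distrib, Finset.sum_add_distrib, Finset.sum_add_distrib, ← Finset.sum_mul,
    ← Finset.sum_mul, hsum, ← Finset.mul_sum, one_mul, one_mul] at hmain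
  have hmax : (1 / s) * max 0 (s * Real.log m + Real.log T) =
      max 0 (Real.log m - (-1 / s) * Real.log T) := by
    rw [mul_max_of_nonneg _ _ (by positivity), mul_zero]
    congr 1
    field_simp
    ring
  rw [hsumle] at hjensen
  have h6 := mul_le_mul_of_nonneg_left (hjensen.trans hlogle) (by positivity : 0 ≤ 1 / s)
  rw [mul_add, hmax] at h6
  have : 1 / s * Real.log 2 = Real.log 2 / s := by ring
  linarith

end Scalar

/-! ### Assembly of the operator and scalar bounds -/

variable {A E : Type*} [Fintype A] [DecidableEq A] [Fintype E] [DecidableEq E]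

lemma condRenyi_blockHom {X : A → Matrix E E ℂ} (hX : ∀ a, (X a).IsHermitian) (s : ℝ) :
    condRenyi s (blockHom X) = (-1 / s) * Real.log
      (∑ a, (matPow (X a) (1 + s) * matPow (∑ b, X b) (-s)).trace.re) := by
  rw [condRenyi, marginalE_blockHom, one_kronecker_eq_blockHom, matPow, cfc_blockHom hX, ← map_mul,
    trace_blockHom, Complex.re_sum]
  rfl

/-- The bound on the modified mutual information after hashing, for a classical-quantum state
with unnormalized conditional states `X a`. -/
lemma exists_hash_modMutualInfo_le {X : A → Matrix E E ℂ} (hX : ∀ a, (X a).PosSemidef)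
    (htr : (∑ a, X a).trace = 1) {M : ℕ} (hM : 1 ≤ M) :
    ∃ f : A → Fin M, ∀ s : ℝ, 0 < s → s ≤ 1 →
      modMutualInfo (blockHom fun i => ∑ a with f a = i, X a) ≤
        Real.log (numEigenvalues (∑ a, X a)) + Real.log 2 / s +
          max 0 (Real.log M - condRenyi s (blockHom X)) := by
  have : NeZero M := ⟨by omega⟩
  have hM0 : (0 : ℝ) < M := by exact_mod_cast hM
  have hR : (∑ a, X a).PosSemidef := Matrix.posSemidef_sum _ fun a _ => hX a
  have hE : Nonempty E := by
    by_contra hE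
    rw [not_nonempty_iff] at hE
    simp [Matrix.trace] at htr
  -- The basis depends on `a`, since the `X a` need not commute; only R is diagonal in all of them.
  choose U r hRU hblock using fun a =>
    exists_unitary_diagonal_and_block_diagonal hR.isHermitian (hX a).isHermitian
  have hUX : ∀ a, (star (U a : Matrix E E ℂ) * X a * U a).PosSemidef := fun a =>
    posSemidef_star_mul_mul (hX a) _
  set y : A → E → ℝ := fun a j => ((star (U a : Matrix E E ℂ) * X a * U a) j j).re with hydef
  have hy : ∀ a j, 0 ≤ y a j := fun a j => re_diag_nonneg (hUX a) j
  set v : ℕ := numEigenvalues (∑ a, X a) with hvdef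
  have hvcard : ∀ a, v = (Finset.univ.image (r a)).card := fun a => by
    rw [hvdef, hRU a, numEigenvalues_conj_diagonal]
  have hA : Nonempty A := by
    by_contra hA
    rw [not_nonempty_iff] at hA
    simp at htr
  have hv1 : 1 ≤ v := by
    obtain ⟨a⟩ := hA
    rw [hvcard a]
    exact Finset.card_pos.2 (Finset.univ_nonempty.image _)
  -- From X_a ≤ R: in particular y vanishes wherever r does, so logarithms and negative powers of r
  -- at 0 never matter.
  have hyr : ∀ a j, y a j ≤ r a j := by
    intro a j
    have h1 : (∑ b, X b - X a).PosSemidef := by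
      rw [← Finset.add_sum_erase _ _ (Finset.mem_univ a), add_sub_cancel_left]
      exact Matrix.posSemidef_sum _ fun b _ => hX b
    have h2 := re_diag_nonneg (posSemidef_star_mul_mul h1 (U a : Matrix E E ℂ)) j
    rw [mul_sub, sub_mul, hRU a, star_mul_conj_mul] at h2
    simpa [hydef] using h2
  have hpinch : ∀ a, (Matrix.diagonal (fun i => (((v : ℝ) * y a i : ℝ) : ℂ)) -
      star (U a : Matrix E E ℂ) * X a * U a).PosSemidef := by
    intro a
    convert posSemidef_smul_diagonal_sub (hUX a) (r a) (hblock a) using 2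
    rw [← hvcard a, ← Matrix.diagonal_smul]
    congr 1
    ext i
    simp only [hydef, Pi.smul_apply, smul_eq_mul]
    rw [Complex.ofReal_mul, ofReal_re_diag (hUX a).isHermitian, Complex.ofReal_natCast]
  obtain ⟨f, hf⟩ := exists_hash_entropy_le hM hX (v : ℝ) U r y (fun _ _ => rfl) hRU hpinch
    (fun a j => (hy a j).trans (hyr a j)) (by exact_mod_cast hv1)
  refine ⟨f, fun s hs hs1 => ?_⟩
  have hsumσ : ∑ i, ∑ a with f a = i, X a = ∑ a, X a := Finset.sum_fiberwise _ _ _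
  rw [modMutualInfo_blockHom (fun i => (Matrix.posSemidef_sum _ fun a _ => hX a).isHermitian)
    (by rw [hsumσ, htr]), hsumσ, Fintype.card_fin, condRenyi_blockHom fun a => (hX a).isHermitian]
  have hRlog : ((∑ a, X a) * matLog (∑ a, X a)).trace.re =
      ∑ a, ∑ j, y a j * Real.log (r a j) := by
    rw [Finset.sum_mul, Matrix.trace_sum, Complex.re_sum]
    refine Finset.sum_congr rfl fun a _ => ?_
    rw [hRU a, matLog, cfc_conj_diagonal, re_trace_mul_conj_diagonal]
  have hT : ∑ p : A × E, y p.1 p.2 ^ (1 + s) * r p.1 p.2 ^ (-s) ≤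
      ∑ a, (matPow (X a) (1 + s) * matPow (∑ b, X b) (-s)).trace.re := by
    rw [Fintype.sum_prod_type]
    refine Finset.sum_le_sum fun a _ => ?_
    rw [hRU a, matPow, matPow, cfc_conj_diagonal, re_trace_mul_conj_diagonal]
    exact Finset.sum_le_sum fun j _ => mul_le_mul_of_nonneg_right
      (rpow_diag_le (hX a) (U a) j (by linarith))
      (Real.rpow_nonneg ((hy a j).trans (hyr a j)) _)
  have hysum : ∑ p : A × E, y p.1 p.2 = 1 := by
    have h1 : ∀ a, ∑ j, y a j = (X a).trace.re := by
      intro a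
      have hUU : (U a : Matrix E E ℂ) * star (U a : Matrix E E ℂ) = 1 :=
        Unitary.coe_mul_star_self (U a)
      rw [← Complex.re_sum]
      change (star (U a : Matrix E E ℂ) * X a * U a).trace.re = _
      rw [Matrix.trace_mul_comm, ← mul_assoc, hUU, one_mul]
    rw [Fintype.sum_prod_type, Finset.sum_congr rfl fun a _ => h1 a, ← Complex.re_sum,
      ← Matrix.trace_sum, htr, Complex.one_re]
  have hbound := sum_mul_log_le (ι := A × E) (y := fun p => y p.1 p.2) (r := fun p => r p.1 p.2)
    (fun p => hy _ _) (fun p => hyr _ _) hysum (v := (v : ℝ)) (m := (M : ℝ))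
    (by exact_mod_cast hv1) hM0 hs hs1 hT
  rw [Fintype.sum_prod_type, Fintype.sum_prod_type] at hbound
  rw [hRlog]
  linarith

end QPA

theorem theorem3 {A E : Type*} [Fintype A] [DecidableEq A] [Fintype E] [DecidableEq E]
    (P : A → ℝ) (hP : QPA.IsProb P)
    (ρ : A → Matrix E E ℂ) (hρ : ∀ a, QPA.IsDensity (ρ a))
    (M : ℕ) (hM : 1 ≤ M) :
    ∃ f : A → Fin M,
      Real.log M - QPA.condEntropy (QPA.hashedState P ρ f)
          = QPA.modMutualInfo (QPA.hashedState P ρ f) ∧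
      ∀ s : ℝ, 0 < s → s ≤ 1 →
        QPA.modMutualInfo (QPA.hashedState P ρ f) ≤
          Real.log (QPA.numEigenvalues (QPA.marginalE (QPA.cqState P ρ)))
            + Real.log 2 / s
            + max 0 (Real.log M - QPA.condRenyi s (QPA.cqState P ρ)) := by
  have hX : ∀ a, ((P a : ℂ) • ρ a).PosSemidef := fun a =>
    (hρ a).1.smul (Complex.zero_le_real.2 (hP.1 a))
  have htr : (∑ a, (P a : ℂ) • ρ a).trace = 1 := by
    simp only [Matrix.trace_sum, Matrix.trace_smul, (hρ _).2, smul_eq_mul, mul_one]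
    exact_mod_cast hP.2
  have : NeZero M := ⟨by omega⟩
  obtain ⟨f, hf⟩ := QPA.exists_hash_modMutualInfo_le hX htr hM
  refine ⟨f, ?_, ?_⟩
  · have hσ : ∀ i, (∑ a with f a = i, (P a : ℂ) • ρ a).IsHermitian := fun i =>
      (Matrix.posSemidef_sum _ fun a _ => hX a).isHermitian
    have hsum : ∑ i, ∑ a with f a = i, (P a : ℂ) • ρ a = ∑ a, (P a : ℂ) • ρ a :=
      Finset.sum_fiberwise _ _ _
    rw [QPA.hashedState_eq_blockHom, QPA.modMutualInfo_blockHom hσ (by rw [hsum, htr]),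
      QPA.condEntropy, QPA.vnEntropy_blockHom hσ, QPA.marginalE_blockHom, QPA.vnEntropy,
      Fintype.card_fin]
    ring
  · intro s hs hs1
    rw [QPA.hashedState_eq_blockHom, QPA.cqState_eq_blockHom, QPA.marginalE_blockHom]
    exact hf s hs hs1
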